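/- Let $\mathcal H=\{x\in\mathbb C:\operatorname{Im}x>0\}$, with the orientation given by the complex structure, and for distinct $x,y\in\mathcal H$ let $$\phi_{x\to y}=\frac1{2\pi}\arg\left(\frac{y-x}{y-\bar x}\right)$$ be Kontsevich's harmonic angle function, with $\arg$ the principal argument. For fixed $y$ let $\mathrm d\phi_{x\to y}$ be its differential in the variable $x$ (defined for almost every $x\in\mathcal H$, namely away from $y$ and from the branch cut, a vertical ray). Then for all $y,z\in\mathcal H$ the integral below converges absolutely and $$\int_{x\in\mathcal H}\mathrm d\phi_{x\to y}\wedge \mathrm d\phi_{x\to z}=\frac1{2\pi i}\log\left(\frac{y-\bar z}{z-\bar y}\right),$$ where $\log$ is the principal branch of the logarithm. -/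

import Mathlib

open MeasureTheory

noncomputable section

namespace Kontsevich

/-- The open upper half-plane, as a subset of the complex plane. -/
def upperHalf : Set ℂ := {x | 0 < x.im}

/-- The harmonic angle function `φ (x, y) = φ_{x → y} = (1 / 2π) arg ((y - x) / (y - x̄))`, with the
principal argument. -/
def phi (x y : ℂ) : ℝ :=
  1 / (2 * Real.pi) * Complex.arg ((y - x) / (y - (starRingEnd ℂ) x))

/-- The one-form `dφ_{x → y}` in the variable `x`, for fixed `y`: the real differential of
`x ↦ φ (x, y)`. For `y` in the upper half-plane this function is smooth on the upper half-plane
away from the closed vertical ray from `y` upwards (the point `y` and the branch cut of the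
argument), which has Lebesgue measure zero. Along the cut `φ` jumps by the constant `1`, so that
the differential has the same limit from both sides; the value there does not affect integrals. -/
def dphi (y x : ℂ) : ℂ →L[ℝ] ℝ :=
  fderiv ℝ (fun w => phi w y) x

/-- The wedge product of two real covectors on the plane, as an alternating bilinear form:
`(α ∧ β) (u, v) = α u * β v - β u * α v`. -/
def wedge (α β : ℂ →L[ℝ] ℝ) : ℂ [⋀^Fin 2]→ₗ[ℝ] ℝ :=
  Matrix.detRowAlternating.compLinearMap
    (LinearMap.pi ![(α : ℂ →ₗ[ℝ] ℝ), (β : ℂ →ₗ[ℝ] ℝ)])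

theorem wedge_apply (α β : ℂ →L[ℝ] ℝ) (u v : ℂ) :
    wedge α β ![u, v] = α u * β v - β u * α v := by
  refine (Matrix.det_fin_two (Matrix.of fun i =>
    LinearMap.pi ![(α : ℂ →ₗ[ℝ] ℝ), (β : ℂ →ₗ[ℝ] ℝ)] (![u, v] i))).trans ?_
  simp

/-- The coefficient of a two-form `ω` on the plane with respect to the positively oriented area
form `d(Re x) ∧ d(Im x)` of the complex structure. -/
def coeff (ω : ℂ → ℂ [⋀^Fin 2]→ₗ[ℝ] ℝ) (x : ℂ) : ℝ :=
  ω x ![1, Complex.I]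

/-- Absolute convergence of the integral of a two-form over a region of the plane. -/
def FormIntegrableOn (ω : ℂ → ℂ [⋀^Fin 2]→ₗ[ℝ] ℝ) (s : Set ℂ) : Prop :=
  IntegrableOn (coeff ω) s volume

/-- The integral of a two-form over a region of the plane, with the standard orientation. -/
def formIntegral (ω : ℂ → ℂ [⋀^Fin 2]→ₗ[ℝ] ℝ) (s : Set ℂ) : ℝ :=
  ∫ x in s, coeff ω x

end Kontsevich

end

/-! The quotient (y - x)/(y - x̄) is a positive multiple of (x - y)(x - ȳ), which is holomorphic in
x. Hence dφ_{x→y} = (1/2π) Im(g_y dx) with g_y = 1/(x - y) + 1/(x - ȳ), and the two-form has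
coefficient (1/4π²) Im(g_y ḡ_z) (`coeff_wedge_dphi`).

Its singularities are of order 1/r, integrable in the plane. At infinity g_y ḡ_z has size |x|⁻²
only, but |g_z|² is real, so Im(g_y ḡ_z) = Im((g_y - g_z) ḡ_z) = O(|x|⁻³).

Fubini then permits integrating over the lines Im x = b first. There g_y ḡ_z is a sum of four
products 1/((a - p)(a - q)), whose integrals depend on the sides of the real axis on which p and q
lie (`integral_inv_mul_inv`). Their imaginary parts are derivatives of arctangents in b
(`integral_lineDensity`), and the total matches the logarithm, which is 2i times an arctangent
(`log_sub_conj_div`). -/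

noncomputable section

namespace Kontsevich

open Complex ComplexConjugate Filter Topology

/-! ### The two-form in terms of logarithmic derivatives -/

/-- The holomorphic function `x ↦ 1 / (x - y) + 1 / (x - ȳ)`, the logarithmic derivative of
`x ↦ (x - y) (x - ȳ)`. -/
def logDerivKernel (y x : ℂ) : ℂ :=
  (x - y)⁻¹ + (x - conj y)⁻¹

theorem phi_eq_arg_mul {x y : ℂ} (hx : 0 < x.im) (hy : 0 < y.im) :
    phi x y = 1 / (2 * Real.pi) * arg ((x - y) * (x - conj y)) := by
  have hne : y - conj x ≠ 0 := fun h => by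
    have := congrArg Complex.im h
    simp at this
    linarith
  have hpos : 0 < (normSq (y - conj x))⁻¹ := inv_pos.2 (normSq_pos.2 hne)
  have : (y - x) / (y - conj x) =
      (((normSq (y - conj x))⁻¹ : ℝ) : ℂ) * ((x - y) * (x - conj y)) := by
    rw [div_eq_mul_inv, Complex.inv_def]
    simp only [map_sub, conj_conj]
    ring
  rw [phi, this, arg_real_mul _ hpos]

theorem hasDerivAt_mul_sub (y x : ℂ) :
    HasDerivAt (fun w : ℂ => (w - y) * (w - conj y)) ((x - conj y) + (x - y)) x := by
  exact (((hasDerivAt_id' x).sub_const y).mul ((hasDerivAt_id' x).sub_const (conj y))).congr_deriv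
    (by simp)

theorem dphi_apply {x y : ℂ} (hx : 0 < x.im) (hy : 0 < y.im) (hxy : x.re ≠ y.re) (v : ℂ) :
    dphi y x v = 1 / (2 * Real.pi) * (logDerivKernel y x * v).im := by
  -- Off the vertical line through y the imaginary part is nonzero, so the principal logarithm is
  -- differentiable there.
  have hslit : (x - y) * (x - conj y) ∈ slitPlane := by
    right
    have : ((x - y) * (x - conj y)).im = 2 * x.im * (x.re - y.re) := by
      simp; ring
    rw [this]
    exact mul_ne_zero (by positivity) (sub_ne_zero.2 hxy)
  have h1 : x - y ≠ 0 := fun h => hxy (by rw [sub_eq_zero.1 h])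
  have h2 : x - conj y ≠ 0 := fun h => hxy (by rw [sub_eq_zero.1 h, conj_re])
  have hd : HasDerivAt (fun w : ℂ => log ((w - y) * (w - conj y))) (logDerivKernel y x) x := by
    convert (hasDerivAt_mul_sub y x).clog hslit using 1
    rw [logDerivKernel]
    field_simp
  have hf := (imCLM.hasFDerivAt.comp x (hd.hasFDerivAt.restrictScalars ℝ)).const_mul
    (1 / (2 * Real.pi))
  have he : (fun w => phi w y) =ᶠ[𝓝 x]
      fun w => 1 / (2 * Real.pi) * (imCLM ∘ fun w : ℂ => log ((w - y) * (w - conj y))) w := by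
    filter_upwards [(isOpen_lt continuous_const continuous_im).mem_nhds hx] with w hw
    rw [phi_eq_arg_mul hw hy, Function.comp_apply, imCLM_apply, log_im]
  rw [dphi, (hf.congr_of_eventuallyEq he).fderiv]
  simp [mul_comm]

theorem coeff_wedge_dphi {x y z : ℂ} (hx : 0 < x.im) (hy : 0 < y.im) (hz : 0 < z.im)
    (hxy : x.re ≠ y.re) (hxz : x.re ≠ z.re) :
    coeff (fun x => wedge (dphi y x) (dphi z x)) x =
      1 / (4 * Real.pi ^ 2) * (logDerivKernel y x * conj (logDerivKernel z x)).im := by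
  rw [coeff, wedge_apply, dphi_apply hx hy hxy, dphi_apply hx hy hxy, dphi_apply hx hz hxz,
    dphi_apply hx hz hxz]
  simp
  field_simp
  ring

/-- Discards a null set containing the branch cut and the singularity. -/
theorem ae_re_ne (r : ℝ) : ∀ᵐ x : ℂ, x.re ≠ r := by
  have h : ∀ᵐ p : ℝ × ℝ, p.1 ≠ r :=
    Measure.quasiMeasurePreserving_fst.ae (Measure.ae_ne volume r)
  exact volume_preserving_equiv_real_prod.quasiMeasurePreserving.ae h

theorem coeff_wedge_dphi_ae {y z : ℂ} (hy : 0 < y.im) (hz : 0 < z.im) :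
    ∀ᵐ x ∂(volume.restrict upperHalf), coeff (fun x => wedge (dphi y x) (dphi z x)) x =
      1 / (4 * Real.pi ^ 2) * (logDerivKernel y x * conj (logDerivKernel z x)).im := by
  have hm : MeasurableSet upperHalf := (isOpen_lt continuous_const continuous_im).measurableSet
  filter_upwards [ae_restrict_of_ae (ae_re_ne y.re), ae_restrict_of_ae (ae_re_ne z.re),
    ae_restrict_mem hm] with x h1 h2 hx
  exact coeff_wedge_dphi hx hy hz h1 h2

/-! ### The logarithm as an arctangent -/

/-- On the right half-plane, `u / ū` has argument twice that of `u`. -/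
theorem log_div_conj {u : ℂ} (hu : 0 < u.re) :
    log (u / conj u) = 2 * Real.arctan (u.im / u.re) * I := by
  have harg : arg u = Real.arctan (u.im / u.re) := by
    have h := abs_arg_lt_pi_div_two_iff.2 (Or.inl hu)
    rw [← tan_arg, Real.arctan_tan (abs_lt.1 h).1 (abs_lt.1 h).2]
  have hu0 : u ≠ 0 := fun h => by simp [h] at hu
  have hexp : u / conj u = exp (2 * arg u * I) := by
    have hpolar := norm_mul_exp_arg_mul_I u
    generalize arg u = θ at hpolar ⊢
    rw [div_eq_iff (by simpa using hu0)]
    conv_lhs => rw [← hpolar]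
    conv_rhs => rw [← hpolar]
    rw [map_mul, conj_ofReal, ← exp_conj, map_mul, conj_ofReal, conj_I, mul_left_comm, ← exp_add,
      show 2 * (θ : ℂ) * I + θ * -I = θ * I by ring]
  have h1 := Real.arctan_lt_pi_div_two (u.im / u.re)
  have h2 := Real.neg_pi_div_two_lt_arctan (u.im / u.re)
  have him : (2 * (Real.arctan (u.im / u.re) : ℂ) * I).im = 2 * Real.arctan (u.im / u.re) := by
    rw [mul_I_im, ← ofReal_ofNat, ← ofReal_mul, ofReal_re]
  rw [hexp, harg, log_exp] <;> rw [him] <;> linarith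

/-- Multiplication by -i turns y - z̄ into a point u of the right half-plane, and the quotient is u
/ ū. -/
theorem log_sub_conj_div {y z : ℂ} (hy : 0 < y.im) (hz : 0 < z.im) :
    log ((y - conj z) / (z - conj y)) =
      2 * Real.arctan ((z.re - y.re) / (y.im + z.im)) * I := by
  have h := log_div_conj (u := -I * (y - conj z)) (by simp; linarith)
  have h1 : (-I * (y - conj z)).re = y.im + z.im := by simp
  have h2 : (-I * (y - conj z)).im = z.re - y.re := by simp
  rw [h1, h2] at h
  rw [← h]
  congr 1
  simp only [map_mul, map_neg, conj_I, map_sub, conj_conj, neg_neg]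
  rw [neg_mul_comm, mul_div_mul_left _ _ I_ne_zero, neg_div, ← div_neg, neg_sub]

/-! ### Integrals of 1/((a - p)(a - q)) over the real line -/

theorem integrable_inv_sub_sq_add_sq (m : ℝ) {h : ℝ} (hh : h ≠ 0) :
    Integrable fun a : ℝ => ((a - m) ^ 2 + h ^ 2)⁻¹ := by
  have h1 := ((integrable_inv_one_add_sq.comp_div hh).comp_sub_right m).const_mul ((h ^ 2)⁻¹)
  refine h1.congr (Eventually.of_forall fun a => ?_)
  simp only
  rw [← mul_inv]
  congr 1
  field_simp
  ring

theorem ofReal_sub_ne_zero {p : ℂ} (hp : p.im ≠ 0) (a : ℝ) : (a : ℂ) - p ≠ 0 := fun h => hp (by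
  simpa using congrArg Complex.im h)

theorem integrable_inv_mul_inv {p q : ℂ} (hp : p.im ≠ 0) (hq : q.im ≠ 0) :
    Integrable fun a : ℝ => ((a : ℂ) - p)⁻¹ * ((a : ℂ) - q)⁻¹ := by
  have hsq : ∀ (p : ℂ) (a : ℝ), ‖((a : ℂ) - p)⁻¹‖ ^ 2 = ((a - p.re) ^ 2 + p.im ^ 2)⁻¹ := by
    intro p a
    rw [norm_inv, inv_pow, Complex.sq_norm, normSq_apply]
    simp
    ring
  refine Integrable.mono' (((integrable_inv_sub_sq_add_sq p.re hp).add
    (integrable_inv_sub_sq_add_sq q.re hq))) ?_ (Eventually.of_forall fun a => ?_)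
  · refine (Continuous.mul ?_ ?_).aestronglyMeasurable
    · exact (continuous_ofReal.sub continuous_const).inv₀ (ofReal_sub_ne_zero hp)
    · exact (continuous_ofReal.sub continuous_const).inv₀ (ofReal_sub_ne_zero hq)
  · rw [norm_mul, Pi.add_apply, ← hsq, ← hsq]
    nlinarith [sq_nonneg (‖((a : ℂ) - p)⁻¹‖ - ‖((a : ℂ) - q)⁻¹‖),
      sq_nonneg (‖((a : ℂ) - p)⁻¹‖), sq_nonneg (‖((a : ℂ) - q)⁻¹‖)]

/-- A primitive of `a ↦ 1 / (a - p)` on the real line, for `p` not real. -/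
def linePrimitive (p : ℂ) (a : ℝ) : ℂ :=
  log ((SignType.sign p.im : ℝ) * I * ((a : ℂ) - p))

/-- The factor ±i rotates the line a - p to real part |Im p| > 0, away from the cut of the
logarithm. -/
theorem hasDerivAt_linePrimitive {p : ℂ} (hp : p.im ≠ 0) (a : ℝ) :
    HasDerivAt (linePrimitive p) ((a : ℂ) - p)⁻¹ a := by
  have hlin : HasDerivAt (fun a : ℝ => (SignType.sign p.im : ℝ) * I * ((a : ℂ) - p))
      ((SignType.sign p.im : ℝ) * I * 1) a :=
    ((hasDerivAt_id a).ofReal_comp.sub_const p).const_mul _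
  have hs : ((SignType.sign p.im : ℝ) : ℂ) ≠ 0 := by
    rcases hp.lt_or_gt with h | h <;> simp [sign_neg, sign_pos, h]
  have hslit : (SignType.sign p.im : ℝ) * I * ((a : ℂ) - p) ∈ slitPlane := by
    left
    rcases hp.lt_or_gt with h | h <;> simp [sign_neg, sign_pos, h]
  refine (hlin.clog_real hslit).congr_deriv ?_
  have := ofReal_sub_ne_zero hp a
  have := I_ne_zero
  field_simp

/-- Both ends of the line at once: e is the direction, and κ(a - p) = (ea) · κ(e - p/(ea)), where
the positive real factor ea splits off the logarithm. -/
theorem tendsto_log_scale {κ p : ℂ} {e : ℝ} (he : e = 1 ∨ e = -1) {l : Filter ℝ}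
    (hl : Tendsto (fun a : ℝ => e * a) l atTop) (hκ : κ * e ∈ slitPlane) :
    Tendsto (fun a : ℝ => log (κ * ((a : ℂ) - p)) - Real.log (e * a)) l (𝓝 (log (κ * e))) := by
  have hinv : Tendsto (fun a : ℝ => ((((e * a)⁻¹ : ℝ)) : ℂ)) l (𝓝 0) := by
    have := (continuous_ofReal.tendsto 0).comp (tendsto_inv_atTop_zero.comp hl)
    simpa [Function.comp_def] using this
  have hmain : Tendsto (fun a : ℝ => κ * (e - p * (((e * a)⁻¹ : ℝ) : ℂ))) l (𝓝 (κ * e)) := by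
    have := (tendsto_const_nhds (x := κ)).mul
      ((tendsto_const_nhds (x := (e : ℂ))).sub ((tendsto_const_nhds (x := p)).mul hinv))
    simpa using this
  refine ((continuousAt_clog hκ).tendsto.comp hmain).congr' ?_
  have hne := hmain.eventually (isOpen_slitPlane.mem_nhds hκ)
  filter_upwards [hl.eventually_gt_atTop 0, hne] with a ha hm
  have hm0 := slitPlane_ne_zero hm
  have hee : (e : ℂ) * e = 1 := by rcases he with rfl | rfl <;> simp
  have : κ * ((a : ℂ) - p) = ((e * a : ℝ) : ℂ) * (κ * (e - p * (((e * a)⁻¹ : ℝ) : ℂ))) := by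
    have ha' : ((e : ℂ) * a) ≠ 0 := by exact_mod_cast ha.ne'
    have : ((e : ℂ) * a) * ((e : ℂ) * a)⁻¹ = 1 := mul_inv_cancel₀ ha'
    push_cast
    linear_combination (- κ * a) * hee + (κ * p) * this
  rw [this, log_ofReal_mul ha hm0]
  simp

theorem tendsto_linePrimitive_atTop {p : ℂ} (hp : p.im ≠ 0) :
    Tendsto (fun a : ℝ => linePrimitive p a - Real.log a) atTop
      (𝓝 ((SignType.sign p.im : ℝ) * (Real.pi / 2) * I)) := by
  have h := tendsto_log_scale (κ := (SignType.sign p.im : ℝ) * I) (p := p) (e := 1)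
    (Or.inl rfl) (l := atTop) (by simp only [one_mul]; exact tendsto_id) (by
      right
      rcases hp.lt_or_gt with h | h <;> simp [sign_neg, sign_pos, h])
  convert h using 2
  · simp [linePrimitive]
  · rcases hp.lt_or_gt with h | h <;> simp [sign_neg, sign_pos, h, log_I, log_neg_I]

theorem tendsto_linePrimitive_atBot {p : ℂ} (hp : p.im ≠ 0) :
    Tendsto (fun a : ℝ => linePrimitive p a - Real.log (-a)) atBot
      (𝓝 (-(SignType.sign p.im : ℝ) * (Real.pi / 2) * I)) := by
  have h := tendsto_log_scale (κ := (SignType.sign p.im : ℝ) * I) (p := p) (e := -1)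
    (Or.inr rfl) (l := atBot) (by simpa using tendsto_neg_atBot_atTop) (by
      right
      rcases hp.lt_or_gt with h | h <;> simp [sign_neg, sign_pos, h])
  convert h using 2
  · simp [linePrimitive]
  · rcases hp.lt_or_gt with h | h <;> simp [sign_neg, sign_pos, h, log_I, log_neg_I]

theorem integral_inv_mul_self {p : ℂ} (hp : p.im ≠ 0) :
    ∫ a : ℝ, ((a : ℂ) - p)⁻¹ * ((a : ℂ) - p)⁻¹ = 0 := by
  have hderiv : ∀ a : ℝ, HasDerivAt (fun a : ℝ => -((a : ℂ) - p)⁻¹)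
      (((a : ℂ) - p)⁻¹ * ((a : ℂ) - p)⁻¹) a := by
    intro a
    have h0 := ofReal_sub_ne_zero hp a
    refine (((hasDerivAt_id a).ofReal_comp.sub_const p).inv h0).neg.congr_deriv ?_
    simp only [id, ofReal_one]
    field_simp
  have hlim : ∀ l : Filter ℝ, Tendsto (fun a : ℝ => (a : ℂ) - p) l (Bornology.cobounded ℂ) →
      Tendsto (fun a : ℝ => -((a : ℂ) - p)⁻¹) l (𝓝 0) := fun l h => by
    simpa using (tendsto_inv₀_cobounded.comp h).neg
  have hcob : ∀ l : Filter ℝ, Tendsto (fun a : ℝ => |a|) l atTop →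
      Tendsto (fun a : ℝ => (a : ℂ) - p) l (Bornology.cobounded ℂ) := fun l h => by
    rw [← tendsto_norm_atTop_iff_cobounded]
    refine tendsto_atTop_mono (fun a => ?_) (tendsto_atTop_add_const_right l (-‖p‖) h)
    have := norm_sub_norm_le (a : ℂ) p
    rwa [norm_real, Real.norm_eq_abs] at this
  rw [integral_of_hasDerivAt_of_tendsto hderiv (integrable_inv_mul_inv hp hp)
    (hlim _ (hcob _ tendsto_abs_atBot_atTop)) (hlim _ (hcob _ tendsto_abs_atTop_atTop)), sub_zero]

/-- By partial fractions; the divergent log |a| cancels in the difference of primitives, and each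
contributes a half turn ±πi. -/
theorem integral_inv_mul_inv {p q : ℂ} (hp : p.im ≠ 0) (hq : q.im ≠ 0) :
    ∫ a : ℝ, ((a : ℂ) - p)⁻¹ * ((a : ℂ) - q)⁻¹ =
      Real.pi * I * ((SignType.sign p.im : ℝ) - (SignType.sign q.im : ℝ)) / (p - q) := by
  -- For p = q the right side is 0 / 0 = 0, which is the correct value.
  rcases eq_or_ne p q with rfl | hpq
  · simp [integral_inv_mul_self hp]
  have hpq' : p - q ≠ 0 := sub_ne_zero.2 hpq
  have hderiv : ∀ a : ℝ, HasDerivAt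
      (fun a => (linePrimitive p a - linePrimitive q a) / (p - q))
      (((a : ℂ) - p)⁻¹ * ((a : ℂ) - q)⁻¹) a := by
    intro a
    refine (((hasDerivAt_linePrimitive hp a).sub (hasDerivAt_linePrimitive hq a)).div_const
      (p - q)).congr_deriv ?_
    have := ofReal_sub_ne_zero hp a
    have := ofReal_sub_ne_zero hq a
    field_simp
    ring
  have htop := ((tendsto_linePrimitive_atTop hp).sub
    (tendsto_linePrimitive_atTop hq)).div_const (p - q)
  have hbot := ((tendsto_linePrimitive_atBot hp).sub
    (tendsto_linePrimitive_atBot hq)).div_const (p - q)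
  simp only [sub_sub_sub_cancel_right] at htop hbot
  rw [integral_of_hasDerivAt_of_tendsto hderiv (integrable_inv_mul_inv hp hq) hbot htop]
  ring

/-! ### Absolute convergence -/

theorem integrableOn_norm_sub_inv_closedBall (p : ℂ) (R : ℝ) :
    IntegrableOn (fun x : ℂ => ‖x - p‖⁻¹) (Metric.closedBall p R) := by
  have h0 : Integrable (fun x : ℂ => (Set.Iic R).indicator (fun r : ℝ => r⁻¹) ‖x‖) := by
    -- In polar coordinates the Jacobian r cancels 1/r.
    rw [integrable_fun_norm_addHaar volume (f := (Set.Iic R).indicator fun r : ℝ => r⁻¹)]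
    have h1 : IntegrableOn (fun _ : ℝ => (1 : ℝ)) (Set.Ioc 0 R) :=
      integrableOn_const (by simp)
    have h2 : IntegrableOn ((Set.Iic R).indicator fun _ : ℝ => (1 : ℝ)) (Set.Ioi 0) := by
      rw [integrableOn_indicator_iff measurableSet_Iic, Set.Iic_inter_Ioi]
      exact h1
    refine h2.congr_fun (fun r hr => ?_) measurableSet_Ioi
    have hr' : r ≠ 0 := ne_of_gt hr
    by_cases h : r ∈ Set.Iic R <;> simp [h, hr']
  have h1 := h0.comp_sub_right p
  rw [← integrable_indicator_iff Metric.isClosed_closedBall.measurableSet]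
  refine h1.congr (Eventually.of_forall fun x => ?_)
  by_cases h : ‖x - p‖ ≤ R <;> simp [Set.indicator, h, dist_eq_norm]

theorem integrableOn_norm_sub_inv {s : Set ℂ} (hs : Bornology.IsBounded s) (p : ℂ) :
    IntegrableOn (fun x : ℂ => ‖x - p‖⁻¹) s := by
  obtain ⟨R, hR⟩ := hs.subset_closedBall p
  exact (integrableOn_norm_sub_inv_closedBall p R).mono_set hR

theorem measurable_logDerivKernel (y : ℂ) : Measurable (logDerivKernel y) := by
  unfold logDerivKernel
  fun_prop

theorem norm_logDerivKernel_le {x y : ℂ} (hx : 0 < x.im) (hy : 0 < y.im) :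
    ‖logDerivKernel y x‖ ≤ ‖x - y‖⁻¹ + y.im⁻¹ := by
  refine (norm_add_le _ _).trans ?_
  rw [norm_inv, norm_inv]
  gcongr
  refine le_trans ?_ (abs_im_le_norm _)
  simp only [sub_im, conj_im, sub_neg_eq_add]
  exact le_trans (by linarith) (le_abs_self _)

/-- Separates the two singularities, by ‖y - z‖ ≤ ‖x - y‖ + ‖x - z‖. -/
theorem norm_inv_mul_norm_inv_le {y z : ℂ} (hyz : y ≠ z) (x : ℂ) :
    ‖x - y‖⁻¹ * ‖x - z‖⁻¹ ≤ ‖y - z‖⁻¹ * (‖x - y‖⁻¹ + ‖x - z‖⁻¹) := by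
  rcases eq_or_ne x y with rfl | hxy
  · simp; positivity
  rcases eq_or_ne x z with rfl | hxz
  · simp; positivity
  have h1 : 0 < ‖x - y‖ := norm_pos_iff.2 (sub_ne_zero.2 hxy)
  have h2 : 0 < ‖x - z‖ := norm_pos_iff.2 (sub_ne_zero.2 hxz)
  have h3 : 0 < ‖y - z‖ := norm_pos_iff.2 (sub_ne_zero.2 hyz)
  have h4 : ‖y - z‖ ≤ ‖x - z‖ + ‖x - y‖ := by
    simpa using norm_sub_le (x - z) (x - y)
  rw [← mul_inv, inv_add_inv h1.ne' h2.ne', inv_mul_eq_div, inv_eq_one_div, div_div,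
    div_le_div_iff₀ (by positivity) (by positivity)]
  nlinarith [mul_pos h1 h2]

theorem norm_mul_conj_logDerivKernel_le {x y z : ℂ} (hx : 0 < x.im) (hy : 0 < y.im)
    (hz : 0 < z.im) (hyz : y ≠ z) :
    ‖(logDerivKernel y x * conj (logDerivKernel z x)).im‖ ≤
      (‖y - z‖⁻¹ + z.im⁻¹) * ‖x - y‖⁻¹ + (‖y - z‖⁻¹ + y.im⁻¹) * ‖x - z‖⁻¹ +
        y.im⁻¹ * z.im⁻¹ := by
  have h1 := norm_logDerivKernel_le hx hy
  have h2 := norm_logDerivKernel_le hx hz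
  calc _ ≤ ‖logDerivKernel y x * conj (logDerivKernel z x)‖ := abs_im_le_norm _
    _ = ‖logDerivKernel y x‖ * ‖logDerivKernel z x‖ := by rw [norm_mul, norm_conj]
    _ ≤ (‖x - y‖⁻¹ + y.im⁻¹) * (‖x - z‖⁻¹ + z.im⁻¹) := by gcongr
    _ ≤ _ := by
      have := norm_inv_mul_norm_inv_le hyz x
      linarith

theorem norm_inv_sub_inv_le {x y z : ℂ} {r : ℝ} (hr : 0 < r) (hy : r ≤ ‖x - y‖)
    (hz : r ≤ ‖x - z‖) : ‖(x - y)⁻¹ - (x - z)⁻¹‖ ≤ ‖y - z‖ * (r⁻¹) ^ 2 := by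
  have h1 : x - y ≠ 0 := norm_pos_iff.1 (hr.trans_le hy)
  have h2 : x - z ≠ 0 := norm_pos_iff.1 (hr.trans_le hz)
  have : (x - y)⁻¹ - (x - z)⁻¹ = (y - z) * ((x - y)⁻¹ * (x - z)⁻¹) := by
    field_simp
    ring
  rw [this, norm_mul, norm_mul, norm_inv, norm_inv, sq]
  gcongr

theorem norm_im_mul_conj_logDerivKernel_le {x y z : ℂ} (hx : 2 * (‖y‖ + ‖z‖) + 1 ≤ ‖x‖) :
    ‖(logDerivKernel y x * conj (logDerivKernel z x)).im‖ ≤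
      256 * ‖y - z‖ * (1 + ‖x‖) ^ (-3 : ℝ) := by
  have hy0 := norm_nonneg y
  have hz0 := norm_nonneg z
  have hr : 0 < ‖x‖ / 2 := by linarith
  have hlow : ∀ p : ℂ, ‖p‖ ≤ ‖y‖ + ‖z‖ → ‖x‖ / 2 ≤ ‖x - p‖ := fun p hp => by
    have := norm_sub_norm_le x p
    linarith
  have h1 := hlow y (by linarith)
  have h2 := hlow z (by linarith)
  have h3 := hlow (conj y) (by rw [norm_conj]; linarith)
  have h4 := hlow (conj z) (by rw [norm_conj]; linarith)
  have hdiff : ‖logDerivKernel y x - logDerivKernel z x‖ ≤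
      2 * ‖y - z‖ * ((‖x‖ / 2)⁻¹) ^ 2 := by
    have e1 := norm_inv_sub_inv_le hr h1 h2
    have e2 := norm_inv_sub_inv_le hr h3 h4
    rw [← map_sub, norm_conj] at e2
    have : logDerivKernel y x - logDerivKernel z x =
        ((x - y)⁻¹ - (x - z)⁻¹) + ((x - conj y)⁻¹ - (x - conj z)⁻¹) := by
      rw [logDerivKernel, logDerivKernel]; ring
    rw [this]
    refine (norm_add_le _ _).trans ?_
    linarith
  have hg : ‖logDerivKernel z x‖ ≤ 2 * (‖x‖ / 2)⁻¹ := by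
    refine (norm_add_le _ _).trans ?_
    rw [norm_inv, norm_inv, two_mul]
    gcongr
  -- The subtracted term |g_z|² is real; this gains the extra power of decay.
  have him : (logDerivKernel y x * conj (logDerivKernel z x)).im =
      ((logDerivKernel y x - logDerivKernel z x) * conj (logDerivKernel z x)).im := by
    rw [sub_mul, mul_conj, sub_im, ofReal_im, sub_zero]
  rw [him]
  calc _ ≤ ‖(logDerivKernel y x - logDerivKernel z x) * conj (logDerivKernel z x)‖ :=
        abs_im_le_norm _
    _ = ‖logDerivKernel y x - logDerivKernel z x‖ * ‖logDerivKernel z x‖ := by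
        rw [norm_mul, norm_conj]
    _ ≤ (2 * ‖y - z‖ * ((‖x‖ / 2)⁻¹) ^ 2) * (2 * (‖x‖ / 2)⁻¹) := by gcongr
    _ = 32 * ‖y - z‖ * (‖x‖⁻¹) ^ 3 := by field_simp; ring
    -- Uses ‖x‖ ≥ 1; the constant is 256 = 32 · 2³.
    _ ≤ 32 * ‖y - z‖ * (2 * (1 + ‖x‖)⁻¹) ^ 3 := by
        gcongr
        rw [← div_eq_mul_inv, inv_eq_one_div, div_le_div_iff₀ (by linarith) (by linarith)]
        linarith
    _ = _ := by
        rw [Real.rpow_neg (by positivity), show (3 : ℝ) = (3 : ℕ) by norm_num, Real.rpow_natCast, ← inv_pow]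
        ring

theorem integrableOn_im_mul_conj_logDerivKernel {y z : ℂ} (hy : 0 < y.im) (hz : 0 < z.im) :
    IntegrableOn (fun x => (logDerivKernel y x * conj (logDerivKernel z x)).im) upperHalf := by
  rcases eq_or_ne y z with rfl | hyz
  -- For y = z the integrand vanishes; the bound near the singularities needs y ≠ z.
  · simp [mul_conj]
  have hH : MeasurableSet upperHalf := (isOpen_lt continuous_const continuous_im).measurableSet
  have hmeas : Measurable fun x => (logDerivKernel y x * conj (logDerivKernel z x)).im :=
    measurable_im.comp ((measurable_logDerivKernel y).mul
      (continuous_conj.measurable.comp (measurable_logDerivKernel z)))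
  set R := 2 * (‖y‖ + ‖z‖) + 1
  have hnear : IntegrableOn (fun x => (logDerivKernel y x * conj (logDerivKernel z x)).im)
      (upperHalf ∩ Metric.closedBall 0 R) := by
    have hb : Bornology.IsBounded (upperHalf ∩ Metric.closedBall (0 : ℂ) R) :=
      Metric.isBounded_closedBall.subset Set.inter_subset_right
    refine Integrable.mono' ((((integrableOn_norm_sub_inv hb y).const_mul
      (‖y - z‖⁻¹ + z.im⁻¹)).add ((integrableOn_norm_sub_inv hb z).const_mul
      (‖y - z‖⁻¹ + y.im⁻¹))).add (integrableOn_const (C := y.im⁻¹ * z.im⁻¹)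
      hb.measure_lt_top.ne)) hmeas.aestronglyMeasurable ?_
    filter_upwards [ae_restrict_mem (hH.inter Metric.isClosed_closedBall.measurableSet)] with x hx
    exact norm_mul_conj_logDerivKernel_le hx.1 hy hz hyz
  have hfar : IntegrableOn (fun x => (logDerivKernel y x * conj (logDerivKernel z x)).im)
      (Metric.closedBall 0 R)ᶜ := by
    -- The exponent 3 exceeds the real dimension 2.
    have hint : Integrable fun x : ℂ => (1 + ‖x‖) ^ (-3 : ℝ) :=
      integrable_one_add_norm (by simp; norm_num)
    refine Integrable.mono' (hint.const_mul (256 * ‖y - z‖)).integrableOn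
      hmeas.aestronglyMeasurable ?_
    filter_upwards [ae_restrict_mem Metric.isClosed_closedBall.measurableSet.compl] with x hx
    refine norm_im_mul_conj_logDerivKernel_le (le_of_lt ?_)
    simpa using hx
  refine (hnear.union hfar).mono_set fun x hx => ?_
  by_cases h : x ∈ Metric.closedBall (0 : ℂ) R
  · exact Or.inl ⟨hx, h⟩
  · exact Or.inr h

/-! ### Integration over the height b -/

/-- The kernel `v ↦ c / (c² + v²)`, the derivative of `v ↦ arctan (v / c)`. -/
def arctanKernel (c v : ℝ) : ℝ :=
  c / (c ^ 2 + v ^ 2)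

theorem arctanKernel_neg (c v : ℝ) : arctanKernel c (-v) = arctanKernel c v := by
  simp [arctanKernel]

theorem integrable_arctanKernel (c d : ℝ) : Integrable fun b : ℝ => arctanKernel c (2 * b + d) := by
  rcases eq_or_ne c 0 with rfl | hc
  · simp [arctanKernel]
  refine ((integrable_inv_sub_sq_add_sq (-d / 2) (h := c / 2) (by simpa)).const_mul
    (c / 4)).congr (Eventually.of_forall fun b => ?_)
  have h1 : (b - -d / 2) ^ 2 + (c / 2) ^ 2 ≠ 0 := by positivity
  have h2 : c ^ 2 + (2 * b + d) ^ 2 ≠ 0 := by positivity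
  simp only [arctanKernel]
  rw [← div_eq_mul_inv, div_eq_div_iff h1 h2]
  ring

theorem integral_Ioi_arctanKernel {c : ℝ} (hc : c ≠ 0) (d r : ℝ) :
    ∫ b in Set.Ioi r, arctanKernel c (2 * b + d) =
      1 / 2 * (SignType.sign c * (Real.pi / 2) - Real.arctan ((2 * r + d) / c)) := by
  have hderiv : ∀ b ∈ Set.Ici r, HasDerivAt (fun b => 1 / 2 * Real.arctan ((2 * b + d) / c))
      (arctanKernel c (2 * b + d)) b := fun b _ => by
    refine (((((hasDerivAt_id' b).const_mul 2).add_const d).div_const c).arctan.const_mul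
      (1 / 2)).congr_deriv ?_
    rw [arctanKernel]
    have : c ^ 2 + (2 * b + d) ^ 2 ≠ 0 := by positivity
    field_simp
  have hlim : Tendsto (fun b => 1 / 2 * Real.arctan ((2 * b + d) / c)) atTop
      (𝓝 (1 / 2 * (SignType.sign c * (Real.pi / 2)))) := by
    refine Tendsto.const_mul _ ?_
    have hlin : Tendsto (fun b : ℝ => 2 * b + d) atTop atTop :=
      tendsto_atTop_add_const_right _ _ (tendsto_id.const_mul_atTop two_pos)
    rcases hc.lt_or_gt with h | h
    · have := (tendsto_nhds_of_tendsto_nhdsWithin Real.tendsto_arctan_atBot).comp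
        (hlin.atTop_div_const_of_neg h)
      simpa [sign_neg h, Function.comp_def] using this
    · have := (tendsto_nhds_of_tendsto_nhdsWithin Real.tendsto_arctan_atTop).comp
        (hlin.atTop_div_const h)
      simpa [sign_pos h, Function.comp_def] using this
  rw [integral_Ioi_of_hasDerivAt_of_tendsto' hderiv (integrable_arctanKernel c d).integrableOn hlim]
  ring

theorem sign_mul_pi_div_two_sub_arctan {c v : ℝ} (hc : c ≠ 0) (hv : 0 < v) :
    SignType.sign c * (Real.pi / 2) - Real.arctan (v / c) = Real.arctan (c / v) := by
  rw [← inv_div v c]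
  rcases hc.lt_or_gt with h | h
  · rw [Real.arctan_inv_of_neg (div_neg_of_pos_of_neg hv h), sign_neg h]
    simp
  · rw [Real.arctan_inv_of_pos (div_pos hv h), sign_pos h]
    simp

/-- For `c = Re (z - y)`, `s = Im y`, `t = Im z`, the integral over the line `Im x = b` of the
imaginary part of `logDerivKernel y x` times the conjugate of `logDerivKernel z x`. -/
def lineDensity (c s t b : ℝ) : ℝ :=
  2 * Real.pi *
    ((Set.Ioi s).indicator (fun b => arctanKernel c (2 * b + (-s - t))) b +
      (Set.Ioi t).indicator (fun b => arctanKernel c (2 * b + (-s - t))) b -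
      arctanKernel c (2 * b + (-s - t)) +
      (Set.Ioi s).indicator (fun b => arctanKernel c (2 * b + (t - s))) b +
      (Set.Ioi t).indicator (fun b => arctanKernel c (2 * b + (s - t))) b +
      arctanKernel c (2 * b + (s + t)))

theorem integral_lineDensity (c : ℝ) {s t : ℝ} (hs : 0 < s) (ht : 0 < t) :
    ∫ b in Set.Ioi 0, lineDensity c s t b = 4 * Real.pi * Real.arctan (c / (s + t)) := by
  rcases eq_or_ne c 0 with rfl | hc
  · simp [lineDensity, arctanKernel]
  have hi : ∀ d, IntegrableOn (fun b => arctanKernel c (2 * b + d)) (Set.Ioi 0) :=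
    fun d => (integrable_arctanKernel c d).integrableOn
  have hind : ∀ r d, IntegrableOn
      ((Set.Ioi r).indicator fun b => arctanKernel c (2 * b + d)) (Set.Ioi 0) :=
    fun r d => ((integrable_arctanKernel c d).indicator measurableSet_Ioi).integrableOn
  have hval : ∀ r d, 0 < r → ∫ b in Set.Ioi 0,
      (Set.Ioi r).indicator (fun b => arctanKernel c (2 * b + d)) b =
      1 / 2 * (SignType.sign c * (Real.pi / 2) - Real.arctan ((2 * r + d) / c)) := by
    intro r d hr
    rw [setIntegral_indicator measurableSet_Ioi, Set.Ioi_inter_Ioi, sup_eq_right.2 hr.le,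
      integral_Ioi_arctanKernel hc]
  simp only [lineDensity]
  rw [integral_const_mul,
    integral_add (((((hind _ _).fun_add (hind _ _)).fun_sub (hi _)).fun_add (hind _ _)).fun_add (hind _ _)) (hi _),
    integral_add ((((hind _ _).fun_add (hind _ _)).fun_sub (hi _)).fun_add (hind _ _)) (hind _ _),
    integral_add (((hind _ _).fun_add (hind _ _)).fun_sub (hi _)) (hind _ _),
    integral_sub ((hind _ _).fun_add (hind _ _)) (hi _),
    integral_add (hind _ _) (hind _ _),
    hval _ _ hs, hval _ _ ht, hval _ _ hs, hval _ _ ht, integral_Ioi_arctanKernel hc,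
    integral_Ioi_arctanKernel hc, ← sign_mul_pi_div_two_sub_arctan hc (add_pos hs ht)]
  -- The values arctan(±(s - t)/c) cancel; the other four terms all involve arctan((s + t)/c).
  rw [show 2 * s + (-s - t) = s - t by ring, show 2 * t + (-s - t) = -(s - t) by ring,
    show 2 * 0 + (-s - t) = -(s + t) by ring, show 2 * s + (t - s) = s + t by ring,
    show 2 * t + (s - t) = s + t by ring, show 2 * 0 + (s + t) = s + t by ring,
    neg_div, neg_div, Real.arctan_neg, Real.arctan_neg]
  ring

/-! ### The integral over a horizontal line -/

theorem integral_im_inv_mul_inv {p q : ℂ} {c : ℝ} (hp : p.im ≠ 0) (hq : q.im ≠ 0)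
    (hc : q.re - p.re = c) :
    (∫ a : ℝ, ((a : ℂ) - p)⁻¹ * ((a : ℂ) - q)⁻¹).im =
      Real.pi * ((SignType.sign q.im : ℝ) - (SignType.sign p.im : ℝ)) *
        arctanKernel c (p.im - q.im) := by
  rw [integral_inv_mul_inv hp hq, arctanKernel, ← hc]
  have h : (Real.pi * I * ((SignType.sign p.im : ℝ) - (SignType.sign q.im : ℝ)) / (p - q) : ℂ) =
      ((Real.pi * ((SignType.sign p.im : ℝ) - (SignType.sign q.im : ℝ)) : ℝ) : ℂ) *
        (I * (p - q)⁻¹) := by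
    push_cast; ring
  rw [h, im_ofReal_mul, I_mul_im, inv_re, normSq_apply, sub_re, sub_im]
  rw [show (p.re - q.re) * (p.re - q.re) + (p.im - q.im) * (p.im - q.im) =
    (q.re - p.re) ^ 2 + (p.im - q.im) ^ 2 by ring]
  ring

theorem sign_sub_eq {r b : ℝ} (h : b ≠ r) (f : ℝ → ℝ) :
    (SignType.sign (b - r) : ℝ) * f b = 2 * (Set.Ioi r).indicator f b - f b := by
  rcases h.lt_or_gt with h | h
  · rw [sign_neg (sub_neg.2 h), Set.indicator_of_notMem (by simpa using h.le)]
    simp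
  · rw [sign_pos (sub_pos.2 h), Set.indicator_of_mem (Set.mem_Ioi.2 h)]
    simp
    ring

/-- On the line, conjugation replaces x = a + bi by a - bi, so all factors have the form 1/(a - p).
Only p₁ and q₁ can change sides as b varies, at b = Im y and b = Im z; this produces the indicators.
-/
theorem integral_line_logDerivKernel {y z : ℂ} (hy : 0 < y.im) (hz : 0 < z.im) {b : ℝ}
    (hb : 0 < b) (hby : b ≠ y.im) (hbz : b ≠ z.im) :
    ∫ a : ℝ, (logDerivKernel y (a + b * I) * conj (logDerivKernel z (a + b * I))).im =
      lineDensity (z.re - y.re) y.im z.im b := by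
  set p₁ := y - b * I with hp₁
  set p₂ := conj y - b * I with hp₂
  set q₁ := conj z + b * I with hq₁
  set q₂ := z + b * I with hq₂
  have ep₁ : p₁.im = -(b - y.im) := by simp [hp₁]
  have ep₂ : p₂.im = -(y.im + b) := by simp [hp₂]; ring
  have eq₁ : q₁.im = b - z.im := by simp [hq₁]; ring
  have eq₂ : q₂.im = z.im + b := by simp [hq₂]
  have np₁ : p₁.im ≠ 0 := by rw [ep₁]; exact neg_ne_zero.2 (sub_ne_zero.2 hby)
  have np₂ : p₂.im ≠ 0 := by rw [ep₂]; linarith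
  have nq₁ : q₁.im ≠ 0 := by rw [eq₁]; exact sub_ne_zero.2 hbz
  have nq₂ : q₂.im ≠ 0 := by rw [eq₂]; linarith
  have hprod : ∀ a : ℝ,
      logDerivKernel y (a + b * I) * conj (logDerivKernel z (a + b * I)) =
        ((a : ℂ) - p₁)⁻¹ * ((a : ℂ) - q₁)⁻¹ + ((a : ℂ) - p₁)⁻¹ * ((a : ℂ) - q₂)⁻¹ +
        (((a : ℂ) - p₂)⁻¹ * ((a : ℂ) - q₁)⁻¹ + ((a : ℂ) - p₂)⁻¹ * ((a : ℂ) - q₂)⁻¹) := by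
    intro a
    have h1 : logDerivKernel y (a + b * I) = ((a : ℂ) - p₁)⁻¹ + ((a : ℂ) - p₂)⁻¹ := by
      rw [logDerivKernel, hp₁, hp₂]
      congr 2 <;> ring
    have h2 : conj (logDerivKernel z (a + b * I)) = ((a : ℂ) - q₁)⁻¹ + ((a : ℂ) - q₂)⁻¹ := by
      simp only [logDerivKernel, hq₁, hq₂, map_add, map_inv₀, map_sub, map_mul, conj_ofReal,
        conj_I, conj_conj]
      congr 2 <;> ring
    rw [h1, h2]
    ring
  have i₁₁ := integrable_inv_mul_inv np₁ nq₁
  have i₁₂ := integrable_inv_mul_inv np₁ nq₂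
  have i₂₁ := integrable_inv_mul_inv np₂ nq₁
  have i₂₂ := integrable_inv_mul_inv np₂ nq₂
  have him := integral_im ((i₁₁.fun_add i₁₂).fun_add (i₂₁.fun_add i₂₂))
  simp only [RCLike.im_eq_complex_im] at him
  simp_rw [hprod]
  rw [him, integral_add (i₁₁.fun_add i₁₂) (i₂₁.fun_add i₂₂),
    integral_add i₁₁ i₁₂, integral_add i₂₁ i₂₂,
    add_im, add_im, add_im,
    integral_im_inv_mul_inv (c := z.re - y.re) np₁ nq₁ (by simp [hp₁, hq₁]),
    integral_im_inv_mul_inv (c := z.re - y.re) np₁ nq₂ (by simp [hp₁, hq₂]),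
    integral_im_inv_mul_inv (c := z.re - y.re) np₂ nq₁ (by simp [hp₂, hq₁]),
    integral_im_inv_mul_inv (c := z.re - y.re) np₂ nq₂ (by simp [hp₂, hq₂]),
    ep₁, ep₂, eq₁, eq₂, Left.sign_neg, Left.sign_neg, sign_pos (show 0 < y.im + b by linarith),
    sign_pos (show 0 < z.im + b by linarith)]
  have k₁₁ : arctanKernel (z.re - y.re) (-(b - y.im) - (b - z.im)) =
      arctanKernel (z.re - y.re) (2 * b + (-y.im - z.im)) := by
    rw [← arctanKernel_neg]; ring_nf
  have k₁₂ : arctanKernel (z.re - y.re) (-(b - y.im) - (z.im + b)) =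
      arctanKernel (z.re - y.re) (2 * b + (z.im - y.im)) := by
    rw [← arctanKernel_neg]; ring_nf
  have k₂₁ : arctanKernel (z.re - y.re) (-(y.im + b) - (b - z.im)) =
      arctanKernel (z.re - y.re) (2 * b + (y.im - z.im)) := by
    rw [← arctanKernel_neg]; ring_nf
  have k₂₂ : arctanKernel (z.re - y.re) (-(y.im + b) - (z.im + b)) =
      arctanKernel (z.re - y.re) (2 * b + (y.im + z.im)) := by
    rw [← arctanKernel_neg]; ring_nf
  rw [k₁₁, k₁₂, k₂₁, k₂₂, lineDensity]
  have s₁ := sign_sub_eq hby fun b => arctanKernel (z.re - y.re) (2 * b + (-y.im - z.im))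
  have s₂ := sign_sub_eq hbz fun b => arctanKernel (z.re - y.re) (2 * b + (-y.im - z.im))
  have s₃ := sign_sub_eq hby fun b => arctanKernel (z.re - y.re) (2 * b + (z.im - y.im))
  have s₄ := sign_sub_eq hbz fun b => arctanKernel (z.re - y.re) (2 * b + (y.im - z.im))
  have hcast : ∀ σ : SignType, ((-σ : SignType) : ℝ) = -(σ : ℝ) := fun σ => by cases σ <;> simp
  rw [hcast, hcast, SignType.coe_one]
  linear_combination Real.pi * (s₁ + s₂ + s₃ + s₄)

/-! ### Fubini and conclusion -/

theorem setIntegral_upperHalf {f : ℂ → ℝ} (hf : IntegrableOn f upperHalf) :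
    ∫ x in upperHalf, f x = ∫ b in Set.Ioi (0 : ℝ), ∫ a : ℝ, f (a + b * I) := by
  have hmp := volume_preserving_equiv_real_prod.symm
  have hemb := measurableEquivRealProd.symm.measurableEmbedding
  have hpre : measurableEquivRealProd.symm ⁻¹' upperHalf = Set.univ ×ˢ Set.Ioi (0 : ℝ) := by
    ext p
    simp [upperHalf, measurableEquivRealProd_symm_apply]
  have hint := (hmp.integrableOn_comp_preimage hemb).2 hf
  rw [← hmp.setIntegral_preimage_emb hemb]
  rw [hpre] at hint ⊢
  rw [IntegrableOn, Measure.volume_eq_prod, ← Measure.prod_restrict, Measure.restrict_univ] at hint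
  rw [Measure.volume_eq_prod, ← Measure.prod_restrict, Measure.restrict_univ]
  refine (integral_prod_symm _ hint).trans ?_
  simp [measurableEquivRealProd_symm_apply, mk_eq_add_mul_I]

theorem integral_im_mul_conj_logDerivKernel {y z : ℂ} (hy : 0 < y.im) (hz : 0 < z.im) :
    ∫ x in upperHalf, (logDerivKernel y x * conj (logDerivKernel z x)).im =
      4 * Real.pi * Real.arctan ((z.re - y.re) / (y.im + z.im)) := by
  rw [setIntegral_upperHalf (integrableOn_im_mul_conj_logDerivKernel hy hz),
    ← integral_lineDensity _ hy hz]
  refine integral_congr_ae ?_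
  filter_upwards [ae_restrict_mem measurableSet_Ioi, ae_restrict_of_ae (Measure.ae_ne volume y.im),
    ae_restrict_of_ae (Measure.ae_ne volume z.im)] with b hb h1 h2
  exact integral_line_logDerivKernel hy hz hb h1 h2

end Kontsevich

end

theorem lemma5p1 (y z : ℂ) (hy : y ∈ Kontsevich.upperHalf) (hz : z ∈ Kontsevich.upperHalf) :
    Kontsevich.FormIntegrableOn
        (fun x => Kontsevich.wedge (Kontsevich.dphi y x) (Kontsevich.dphi z x))
        Kontsevich.upperHalf ∧
      ((Kontsevich.formIntegral
          (fun x => Kontsevich.wedge (Kontsevich.dphi y x) (Kontsevich.dphi z x))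
          Kontsevich.upperHalf : ℝ) : ℂ) =
        1 / (2 * (Real.pi : ℂ) * Complex.I) *
          Complex.log ((y - (starRingEnd ℂ) z) / (z - (starRingEnd ℂ) y)) := by
  have hae := Kontsevich.coeff_wedge_dphi_ae hy hz
  constructor
  · exact ((Kontsevich.integrableOn_im_mul_conj_logDerivKernel hy hz).const_mul _).congr
      (hae.mono fun x hx => hx.symm)
  · rw [Kontsevich.formIntegral, integral_congr_ae hae, integral_const_mul,
      Kontsevich.integral_im_mul_conj_logDerivKernel hy hz, Kontsevich.log_sub_conj_div hy hz]
    have hpi : (Real.pi : ℂ) ≠ 0 := by exact_mod_cast Real.pi_ne_zero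
    have hI := Complex.I_ne_zero
    push_cast
    field_simp
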